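/- **Conventions.** $\omega$ is the set of natural numbers, $\langle\cdot,\cdot\rangle:\omega^2\to\omega$ is a fixed computable bijection, ${}^{<\omega}\omega$ is the set of finite strings with prefix order $\preceq$, and $\ulcorner\cdot\urcorner:{}^{<\omega}\omega\to\omega$ is a fixed computable bijection. An *upper set* over $\omega$ is a non-empty family $\mathcal U\subseteq\mathcal P(\omega)$ with $\emptyset\notin\mathcal U$ that is closed under supersets. $\mathcal U\le_{K}\mathcal V$ (Katětov) means that there is $h:\omega\to\omega$ with $A\in\mathcal U\Rightarrow h^{-1}[A]\in\mathcal V$ for all $A\subseteq\omega$; $\mathcal U\le_{RK}\mathcal V$ (Rudin–Keisler) is the same with $\Leftrightarrow$. The Fubini product is $\mathcal U\otimes\mathcal V=\{A\subseteq\omega:\{m:\{l:\langle m,l\rangle\in A\}\in\mathcal V\}\in\mathcal U\}$. A *tree* is a set $T\subseteq{}^{<\omega}\omega$ that contains the empty string and is closed under prefixes; $[T]$ is its set of infinite paths. $T$ is *$\mathcal V$-branching* if $\{n:\sigma^\frown n\in T\}\in\mathcal V$ for every $\sigma\in T$. A *partial continuous function* $\Phi:\subseteq{}^\omega\omega\to\omega$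 is one given by a partial $\varphi:\subseteq{}^{<\omega}\omega\to\omega$ with $\varphi(\sigma)=\varphi(\tau)$ whenever $\sigma\preceq\tau$ are in its domain, through $\Phi(p)=c$ iff $\varphi(p{\upharpoonright}n)=c$ for some $n$. The *Gamified Katětov order*: $\mathcal U\le^{\circ}_{LT}\mathcal V$ iff there is a partial continuous $\Phi$ such that for every $A\in\mathcal U$ there is a $\mathcal V$-branching tree $T$ with $[T]\subseteq\operatorname{dom}\Phi$ and $\Phi([T])\subseteq A$. For an antichain $\delta\subseteq{}^{<\omega}\omega$, a tree $T$ is *$\mathcal V$-branching up to $\delta$* if every path in $[T]$ has a prefix in $\delta$ and every $\sigma\in T\setminus\delta$ satisfies $\{n:\sigma^\frown n\in T\}\in\mathcal V$. A *$\mathcal V$-fence* is an antichain $\delta$ for which such a $T$ exists, and $\mathcal V^{\otimes[\delta]}$ is the closure under supersets in $\mathcal P(\omega)$ of $\{\{\ulcorner\sigma\urcorner:\sigma\in T\cap\delta\}: T$ is $\mathcal V$-branching up to $\delta\}$. In the *finite-query Katětov game* $\mathfrak G(\mathcal U,\mathcal V)$, Player I first picks $A\in\mathcal U$. In round $n\ge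 0$, Player II$_0$, seeing only $(x_1,\dots,x_n)$, either makes a query or ends the game with an output $y\in\omega$ (in round $0$ it must make a query); upon a query Player II$_1$, seeing $(A,x_1,\dots,x_n)$, plays some $B_n\in\mathcal V$, and Player I answers with $x_{n+1}\in B_n$. A strategy of Player II is a pair of partial functions for II$_0$ and II$_1$; it is winning if, as long as Player I obeys the rules, II$_0$ and II$_1$ make legal moves and every play ends after finitely many rounds with $y\in A$. $\mathcal U$ is *computable Gamified Katětov reducible* to $\mathcal V$ if Player II has a winning strategy in which the strategy of II$_0$ is partial computable. Let $\varphi_e$ be the $e$-th partial computable function and $p\to q=\{e:\forall a\in p\ (\varphi_e(a){\downarrow}\in q)\}$ for $p,q\subseteq\omega$. For $j,k:\mathcal P(\omega)\to\mathcal P(\omega)$ let $j\le_{LT}k$ mean that some $e$ lies in $j(p)\to k(p)$ for all $p$. A *Lawvere–Tierney (LT) topology* in the effective topos $\mathrm{Eff}$ is a map $j:\mathcal P(\omega)\to\mathcal P(\omega)$ for which $(p\to q)\to(j(p)\to j(q))$, $p\to j(p)$, $j(j(p))\to j(p)$ and $j(p)\to j(j(p))$ are each realised by one number uniformly in $p,q$.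 The *basic topology* of $\mathcal U$ is $j_{\mathcal U}(p)=\bigcap\{q\subseteq\omega:\langle0,a\rangle\in q\ \forall a\in p,\ \langle1,b\rangle\in q\ \forall b\in G_{\mathcal U}(q)\}$, where $G_{\mathcal U}(q)=\bigcup_{A\in\mathcal U}(A\to q)$. The *LT-game* of $\mathcal U,\mathcal V$ (viewed as constant sequences indexed by $\omega$): Merlin picks a public $x_0\in\omega$ and a secret $A\in\mathcal U$; in round $n$ Arthur, by a partial computable strategy applied to $(x_0,\dots,x_n)$, either makes a query $\langle0,u\rangle$ or ends the game with output $u$ by playing $\langle1,u\rangle$; upon a query Nimue, who sees everything, plays $B_n\in\mathcal V$, and Merlin answers with $x_{n+1}\in B_n$. Arthur and Nimue win if, as long as Merlin obeys the rules, they move legally and every play ends after finitely many rounds with $u\in A$. **Theorem A.** The relation $\le^{\circ}_{LT}$ is a preorder on upper sets over $\omega$. Moreover, for all upper sets $\mathcal U,\mathcal V$ over $\omega$: (i) $\mathcal U\le^{\circ}_{LT}\mathcal V$ iff $\mathcal U\le_K\mathcal V^{\otimes[\delta]}$ for some $\mathcal V$-fence $\delta$. In particular, $\mathcal U\otimes\mathcal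 U$ is an upper set and $\mathcal U\equiv^{\circ}_{LT}\mathcal U\otimes\mathcal U$. The order $\le^\circ_{LT}$ is strictly coarser than $\le_K$ and $\le_{RK}$: each of $\mathcal U\le_K\mathcal V$ and $\mathcal U\le_{RK}\mathcal V$ implies $\mathcal U\le^\circ_{LT}\mathcal V$, and there are upper sets $\mathcal U_0\le^\circ_{LT}\mathcal V_0$ with $\mathcal U_0\not\le_K\mathcal V_0$ and $\mathcal U_0\not\le_{RK}\mathcal V_0$. (ii) $\mathcal U\le^{\circ}_{LT}\mathcal V$ iff Player II has a winning strategy in $\mathfrak G(\mathcal U,\mathcal V)$. (iii) The computable Gamified Katětov order coincides with $\le_{LT}$ on upper sets: $j_{\mathcal U}$ is an LT topology, $\le_{LT}$-least among the LT topologies $k$ with $G_{\mathcal U}\le_{LT}k$, and the following are equivalent: $\mathcal U$ is computable Gamified Katětov reducible to $\mathcal V$; $j_{\mathcal U}\le_{LT}j_{\mathcal V}$; Arthur and Nimue have a winning strategy in the LT-game of $\mathcal U,\mathcal V$. -/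

import Mathlib

namespace GamKat

/-! ### Subset families, the Katetov and Rudin-Keisler orders, Fubini products -/

/-- An upper set over `ω`: a family of subsets of `ω` closed under supersets, non-empty, and
not containing `∅`. -/
structure IsUpperFamily (U : Set (Set ℕ)) : Prop where
  upward : ∀ A B : Set ℕ, A ∈ U → A ⊆ B → B ∈ U
  nonempty : U.Nonempty
  empty_notMem : (∅ : Set ℕ) ∉ U

/-- The Katetov order. -/
def KatetovLE (U V : Set (Set ℕ)) : Prop :=
  ∃ h : ℕ → ℕ, ∀ A : Set ℕ, A ∈ U → h ⁻¹' A ∈ V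

/-- The Rudin-Keisler order. -/
def RudinKeislerLE (U V : Set (Set ℕ)) : Prop :=
  ∃ h : ℕ → ℕ, ∀ A : Set ℕ, A ∈ U ↔ h ⁻¹' A ∈ V

/-- The Fubini product, as a family of subsets of `ω` through the pairing `Nat.pair`. -/
def fubini (U V : Set (Set ℕ)) : Set (Set ℕ) :=
  {A | {m : ℕ | {l : ℕ | Nat.pair m l ∈ A} ∈ V} ∈ U}

/-- Upward closure of a family of subsets of `ω`. -/
def upClosure (F : Set (Set ℕ)) : Set (Set ℕ) :=
  {X | ∃ A ∈ F, A ⊆ X}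

/-! ### Strings, trees, partial continuous functions

Finite strings are lists; `σ` followed by `n` is `σ ++ [n]`, and `σ <+: τ` is the prefix
relation. -/

/-- The prefix of length `n` of an infinite string. -/
def restr (x : ℕ → ℕ) (n : ℕ) : List ℕ :=
  (List.range n).map x

/-- A tree: a set of strings containing the empty string and closed under prefixes. -/
structure IsTree (T : Set (List ℕ)) : Prop where
  root_mem : [] ∈ T
  prefix_mem : ∀ σ τ : List ℕ, τ <+: σ → σ ∈ T → τ ∈ T

/-- Infinite paths through a tree. -/
def paths (T : Set (List ℕ)) : Set (ℕ → ℕ) :=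
  {x | ∀ n, restr x n ∈ T}

/-- The set of immediate successors of a node. -/
def succs (T : Set (List ℕ)) (σ : List ℕ) : Set ℕ :=
  {n | σ ++ [n] ∈ T}

/-- A `V`-branching tree. -/
structure IsBranchingTree (V : Set (Set ℕ)) (T : Set (List ℕ)) : Prop where
  tree : IsTree T
  branching : ∀ σ ∈ T, succs T σ ∈ V

/-- A partial function on infinite strings is partial continuous if it is determined by a coherent
partial function `φ` on finite strings. -/
def IsPartialContinuous (Φ : (ℕ → ℕ) →. ℕ) : Prop :=
  ∃ φ : List ℕ →. ℕ,
    (∀ σ τ : List ℕ, (φ σ).Dom → (φ τ).Dom → σ <+: τ → φ σ = φ τ) ∧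
    ∀ (p : ℕ → ℕ) (c : ℕ), c ∈ Φ p ↔ ∃ n, c ∈ φ (restr p n)

/-- The Gamified Katetov order. -/
def GamifiedKatetovLE (U V : Set (Set ℕ)) : Prop :=
  ∃ Φ : (ℕ → ℕ) →. ℕ, IsPartialContinuous Φ ∧
    ∀ A ∈ U, ∃ T : Set (List ℕ), IsBranchingTree V T ∧
      paths T ⊆ Φ.Dom ∧ ∀ p ∈ paths T, ∀ c ∈ Φ p, c ∈ A

/-! ### Fences and `δ`-Fubini powers -/

/-- A tree that is `V`-branching up to `δ`. -/
structure IsBranchingUpTo (V : Set (Set ℕ)) (δ T : Set (List ℕ)) : Prop where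
  tree : IsTree T
  meets : ∀ x ∈ paths T, ∃ n, restr x n ∈ δ
  branching : ∀ σ ∈ T, σ ∈ δ ∨ succs T σ ∈ V

/-- A `V`-fence: an antichain of strings that admits a `V`-branching tree up to it. -/
structure IsFence (V : Set (Set ℕ)) (δ : Set (List ℕ)) : Prop where
  antichain : ∀ σ ∈ δ, ∀ τ ∈ δ, σ <+: τ → σ = τ
  exists_tree : ∃ T : Set (List ℕ), IsBranchingUpTo V δ T

/-- The `δ`-Fubini power of `V`; strings are coded by the computable bijection
`Encodable.encode : List ℕ → ℕ`. -/
def deltaFubini (V : Set (Set ℕ)) (δ : Set (List ℕ)) : Set (Set ℕ) :=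
  upClosure {X | ∃ T : Set (List ℕ), IsBranchingUpTo V δ T ∧ X = Encodable.encode '' (T ∩ δ)}

/-! ### The finite-query Katetov game -/

/-- A strategy of Player II₀: it sees only the answers `(x₁, …, xₙ)` of Player I, and it makes a
query (value `0`) or terminates with output `y` (value `⟨1, y⟩`). The first decision is always a
query, and nothing is specified after termination. -/
structure IsDecisionStrategy (ψ : List ℕ →. ℕ) : Prop where
  start : 0 ∈ ψ []
  legal : ∀ σ v, v ∈ ψ σ → v = 0 ∨ ∃ y, v = Nat.pair 1 y
  halted : ∀ σ y τ, Nat.pair 1 y ∈ ψ σ → σ <+: τ → σ ≠ τ → ¬ (ψ τ).Dom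

/-- `GamePosition ψ η A (x₁, …, xₙ)`: the sequence `(x₁, …, xₙ)` is a legal sequence of answers of
Player I, who opened with `A`, against the strategies `ψ` of Player II₀ and `η` of Player II₁. -/
inductive GamePosition (ψ : List ℕ →. ℕ) (η : Set ℕ × List ℕ →. Set ℕ) (A : Set ℕ) :
    List ℕ → Prop
  | nil : GamePosition ψ η A []
  | snoc (σ : List ℕ) (B : Set ℕ) (x : ℕ) : GamePosition ψ η A σ → 0 ∈ ψ σ → B ∈ η (A, σ) →
      x ∈ B → GamePosition ψ η A (σ ++ [x])

/-- The pair `(ψ, η)` is a winning strategy of Player II: as long as Player I obeys the rules,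
Player II₀ always moves, Player II₁ answers queries with members of `V`, a declared output lies in
Player I's set `A`, and there is no infinite play. -/
structure IsWinningStrategy (U V : Set (Set ℕ)) (ψ : List ℕ →. ℕ)
    (η : Set ℕ × List ℕ →. Set ℕ) : Prop where
  decision : IsDecisionStrategy ψ
  moves : ∀ A ∈ U, ∀ σ, GamePosition ψ η A σ → (ψ σ).Dom
  query : ∀ A ∈ U, ∀ σ, GamePosition ψ η A σ → 0 ∈ ψ σ → ∃ B ∈ η (A, σ), B ∈ V
  valid : ∀ A ∈ U, ∀ σ, GamePosition ψ η A σ → ∀ y, Nat.pair 1 y ∈ ψ σ → y ∈ A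
  terminates : ∀ A ∈ U, ∀ x : ℕ → ℕ, ∃ n, ¬ GamePosition ψ η A (restr x n)

/-- Player II has a winning strategy in the finite-query Katetov game. -/
def PlayerIIWins (U V : Set (Set ℕ)) : Prop :=
  ∃ ψ η, IsWinningStrategy U V ψ η

/-- Computable Gamified Katetov reducibility: Player II has a winning strategy in which the
strategy of Player II₀ is partial computable. -/
def ComputableGamifiedKatetovLE (U V : Set (Set ℕ)) : Prop :=
  ∃ ψ η, Partrec ψ ∧ IsWinningStrategy U V ψ η

/-! ### The LT-game of (partial) sequences of families -/

/-- `LTPosition φ ν x₀ A σ`: `σ = (x₀, x₁, …, xₙ)` is a legal sequence of public moves of Merlin,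
who opened with `x₀` and the secret set `A`, against Arthur's `φ` and Nimue's `ν`. -/
inductive LTPosition (φ : List ℕ →. ℕ) (ν : Set ℕ × List ℕ →. Set ℕ) (x₀ : ℕ) (A : Set ℕ) :
    List ℕ → Prop
  | start : LTPosition φ ν x₀ A [x₀]
  | snoc (σ : List ℕ) (u : ℕ) (B : Set ℕ) (x : ℕ) : LTPosition φ ν x₀ A σ →
      Nat.pair 0 u ∈ φ σ → B ∈ ν (A, σ) → x ∈ B → LTPosition φ ν x₀ A (σ ++ [x])

/-- Arthur and Nimue win the LT-game with the strategies `φ` (partial computable) and `ν`. -/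
structure IsLTWinning (U V : ℕ →. Set (Set ℕ)) (φ : List ℕ →. ℕ)
    (ν : Set ℕ × List ℕ →. Set ℕ) : Prop where
  computable : Partrec φ
  moves : ∀ x₀, ∀ F ∈ U x₀, ∀ A ∈ F, ∀ σ, LTPosition φ ν x₀ A σ →
    (∃ u, Nat.pair 0 u ∈ φ σ ∧ ∃ G ∈ V u, ∃ B ∈ ν (A, σ), B ∈ G) ∨
    (∃ u, Nat.pair 1 u ∈ φ σ ∧ u ∈ A)
  terminates : ∀ x₀, ∀ F ∈ U x₀, ∀ A ∈ F, ∀ x : ℕ → ℕ,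
    ∃ n, 0 < n ∧ ¬ LTPosition φ ν x₀ A (restr x n)

/-- LT-reducibility of partial sequences of families, through the LT-game. -/
def LTGameLE (U V : ℕ →. Set (Set ℕ)) : Prop :=
  ∃ φ ν, IsLTWinning U V φ ν

/-- A family seen as a constant total sequence. -/
def constSeq (U : Set (Set ℕ)) : ℕ →. Set (Set ℕ) :=
  fun _ => Part.some U

/-! ### Lawvere-Tierney topologies in the effective topos -/

/-- The `e`-th partial computable function. -/
def pcf (e : ℕ) : ℕ →. ℕ :=
  (Denumerable.ofNat Nat.Partrec.Code e).eval

/-- Realisability implication `p → q`. -/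
def rimp (p q : Set ℕ) : Set ℕ :=
  {e | ∀ a ∈ p, ∃ b ∈ pcf e a, b ∈ q}

/-- `∀ p. j(p) → k(p)` is valid. -/
def LTLE (j k : Set ℕ → Set ℕ) : Prop :=
  ∃ e, ∀ p, e ∈ rimp (j p) (k p)

/-- Lawvere-Tierney topologies in the effective topos: the axioms hold in the sense of
realisability, uniformly in the propositions. -/
structure IsLTTopology (j : Set ℕ → Set ℕ) : Prop where
  mono : ∃ e, ∀ p q, e ∈ rimp (rimp p q) (rimp (j p) (j q))
  unit : ∃ e, ∀ p, e ∈ rimp p (j p)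
  idem : LTLE (fun p => j (j p)) j ∧ LTLE j (fun p => j (j p))

/-- The operator `p ↦ ⋃_{A ∈ U} (A → p)`. -/
def genOp (U : Set (Set ℕ)) (p : Set ℕ) : Set ℕ :=
  ⋃ A ∈ U, rimp A p

/-- The basic topology of `U`: the reflection of `genOp U` into Lawvere-Tierney topologies,
`p ↦ ⋂ {q | {0} ∧ p ⊆ q and {1} ∧ genOp U q ⊆ q}`. -/
def basicTopology (U : Set (Set ℕ)) (p : Set ℕ) : Set ℕ :=
  ⋂₀ {q | (∀ a ∈ p, Nat.pair 0 a ∈ q) ∧ ∀ b ∈ genOp U q, Nat.pair 1 b ∈ q}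

/-- `j` is an `LTLE`-least Lawvere-Tierney topology above the operator `g`. -/
structure IsLeastLTTopologyAbove (g j : Set ℕ → Set ℕ) : Prop where
  topology : IsLTTopology j
  above : LTLE g j
  least : ∀ k, IsLTTopology k → LTLE g k → LTLE j k

end GamKat

namespace GamKat

/-! ### Infinite strings and bars -/

/-! Every non-computable notion here says that one procedure, fixed before the secret set `A` is
chosen, reads finitely many adversarial answers and outputs an element of `A`, each answer being
confined to a member of `V` that may depend on `A`. `StoppingLE` isolates this: a stopping function
`φ` decides when to output, and for every `A ∈ U` the inductive predicate `Bar` says that an output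
in `A` can be forced. Trees, fences and plays are all translated to and from it: `Bar.of_invariant`
obtains a bar from the absence of infinite escapes, and `Bar.exists_tree` turns a bar into a
well-founded tree. Transitivity is substitution of procedures (`StoppingLE.trans`).

For the computable version, the basic topology is a least fixed point, so a member of `basicTopology
V A` is a code of a well-founded strategy: tag `0` outputs, tag `1` queries and continues by a
partial computable function. A reduction is then a single number lying in `basicTopology V A` for
all `A ∈ U` (`RealizerLE`). The recursion theorem converts strategies into such numbers
(`RealizerLE.of_bar`), and running the number gives a strategy back. -/

theorem restr_succ (x : ℕ → ℕ) (n : ℕ) : restr x (n + 1) = restr x n ++ [x n] := by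
  simp [restr, List.range_succ]

theorem length_restr (x : ℕ → ℕ) (n : ℕ) : (restr x n).length = n := by
  simp [restr]

theorem restr_prefix (x : ℕ → ℕ) {m n : ℕ} (h : m ≤ n) : restr x m <+: restr x n := by
  induction h with
  | refl => exact List.prefix_rfl
  | step _ ih => exact ih.trans (by rw [restr_succ]; exact List.prefix_append _ _)

theorem restr_cons (a : ℕ) (x : ℕ → ℕ) (n : ℕ) :
    restr (fun i => Nat.casesOn i a x) (n + 1) = a :: restr x n := by
  induction n with
  | zero => rfl
  | succ n ih => rw [restr_succ, ih, restr_succ]; rfl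

theorem tail_restr_succ (x : ℕ → ℕ) (n : ℕ) :
    (restr x (n + 1)).tail = restr (fun i => x (i + 1)) n := by
  have hx : x = fun i => Nat.casesOn i (x 0) fun i => x (i + 1) := by
    funext i
    cases i <;> rfl
  rw [hx, restr_cons]
  rfl

theorem restr_getD (σ : List ℕ) : restr (fun i => σ.getD i 0) σ.length = σ := by
  apply List.ext_getElem
  · simp [restr]
  · intro i h1 h2
    simp [restr, h2]

theorem prefix_snoc_iff {τ σ : List ℕ} {x : ℕ} :
    τ <+: σ ++ [x] ↔ τ = σ ++ [x] ∨ τ <+: σ := by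
  simpa using (List.prefix_concat_iff (l₁ := τ) (l₂ := σ) (a := x))

theorem prefix_dropLast_of_ne {σ τ : List ℕ} (h : σ <+: τ) (hne : σ ≠ τ) :
    σ <+: τ.dropLast := by
  rcases List.eq_nil_or_concat' τ with rfl | ⟨ρ, x, rfl⟩
  · exact absurd (List.prefix_nil.1 h) hne
  · rcases prefix_snoc_iff.1 h with h | h
    · exact absurd h hne
    · simpa using h

/-- A serial property of finite strings holds along an infinite string. -/
theorem exists_path_of_serial (P : List ℕ → Prop) (σ : List ℕ) (hσ : P σ)
    (hs : ∀ τ, P τ → ∃ x, P (τ ++ [x])) :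
    ∃ x : ℕ → ℕ, restr x σ.length = σ ∧ ∀ n, σ.length ≤ n → P (restr x n) := by
  classical
  choose f hf using hs
  let g : List ℕ → ℕ := fun τ => if h : P τ then f τ h else 0
  let s : ℕ → List ℕ := fun n => Nat.rec σ (fun _ τ => τ ++ [g τ]) n
  have hs : ∀ n, s (n + 1) = s n ++ [g (s n)] := fun n => rfl
  have hP : ∀ n, P (s n) := by
    intro n
    induction n with
    | zero => exact hσ
    | succ n ih =>
      rw [hs]
      have : g (s n) = f (s n) ih := dif_pos ih
      rw [this]
      exact hf _ ih
  let x : ℕ → ℕ := fun i => if i < σ.length then σ.getD i 0 else g (s (i - σ.length))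
  have h0 : restr x σ.length = σ := by
    conv_rhs => rw [← restr_getD σ]
    unfold restr
    apply List.map_congr_left
    intro i hi
    simp only [x, if_pos (List.mem_range.1 hi)]
  have hx : ∀ n, restr x (σ.length + n) = s n := by
    intro n
    induction n with
    | zero => exact h0
    | succ n ih =>
      rw [← add_assoc, restr_succ, ih, hs]
      simp [x]
  refine ⟨x, h0, fun n hn => ?_⟩
  obtain ⟨m, rfl⟩ := Nat.exists_eq_add_of_le hn
  rw [hx]
  exact hP m

/-- `Bar V D Q σ`: starting from `σ`, and extending the current string at the strings in `Q` by
adversarial choices from suitable members of `V`, one reaches `D` after finitely many steps. -/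
inductive Bar (V : Set (Set ℕ)) (D Q : List ℕ → Prop) : List ℕ → Prop
  | reach (σ : List ℕ) : D σ → Bar V D Q σ
  | ask (σ : List ℕ) (B : Set ℕ) : Q σ → B ∈ V → (∀ x ∈ B, Bar V D Q (σ ++ [x])) → Bar V D Q σ

/-- Classical bar induction: at an unbarred string satisfying `P`, some answer in the available `B`
is again unbarred, since otherwise `ask` would apply. Iterating gives an infinite unbarred path
inside `P`, which `ht` excludes. -/
theorem Bar.of_invariant {V : Set (Set ℕ)} {D Q P : List ℕ → Prop} (h0 : P [])
    (hs : ∀ σ, P σ → D σ ∨ Q σ ∧ ∃ B ∈ V, ∀ x ∈ B, P (σ ++ [x]))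
    (ht : ∀ x : ℕ → ℕ, (∀ n, P (restr x n)) → ∃ n, D (restr x n)) : Bar V D Q [] := by
  by_contra hb
  obtain ⟨x, -, hx⟩ := exists_path_of_serial (fun σ => P σ ∧ ¬ Bar V D Q σ) [] ⟨h0, hb⟩ (by
    rintro σ ⟨hP, hB⟩
    rcases hs σ hP with hD | ⟨hQ, B, hBV, hBP⟩
    · exact absurd (.reach _ hD) hB
    · by_contra hne
      push Not at hne
      exact hB (.ask _ B hQ hBV fun x hx => hne x (hBP x hx)))
  obtain ⟨n, hn⟩ := ht x fun n => (hx n (Nat.zero_le _)).1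
  exact (hx n (Nat.zero_le _)).2 (.reach _ hn)

/-- A bar is witnessed by a well-founded tree whose inner nodes lie in `Q` and branch in `V`, and
whose leaves lie in `D`. -/
structure IsBarTree (V : Set (Set ℕ)) (D Q : List ℕ → Prop) (T : Set (List ℕ)) : Prop where
  tree : IsTree T
  node : ∀ σ ∈ T, (D σ ∧ ∀ x, σ ++ [x] ∉ T) ∨ (Q σ ∧ succs T σ ∈ V)
  wellFounded : ∀ x : ℕ → ℕ, ∃ n, restr x n ∉ T

theorem Bar.exists_tree_above {V : Set (Set ℕ)} {D Q : List ℕ → Prop} {σ : List ℕ}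
    (h : Bar V D Q σ) :
    ∃ T, IsBarTree V (fun ρ => D (σ ++ ρ)) (fun ρ => Q (σ ++ ρ)) T := by
  induction h with
  | reach σ hD =>
    refine ⟨{[]}, ⟨rfl, ?_⟩, ?_, fun x => ⟨1, ?_⟩⟩
    · rintro _ τ hτ rfl
      exact List.prefix_nil.1 hτ
    · rintro _ rfl
      exact .inl ⟨by simpa using hD, by simp⟩
    · simp [restr_succ]
  | ask σ B hQ hB _ ih =>
    choose T hT using ih
    -- The trees of the children are glued under a new root; the condition is vacuous at the empty
    -- string, which is therefore a node.
    refine ⟨{ρ | ∀ x τ, ρ = x :: τ → ∃ h : x ∈ B, τ ∈ T x h}, ⟨?_, ?_⟩, ?_, fun x => ?_⟩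
    · rintro x τ h
      cases h
    · rintro ρ _ hρ hmem x τ rfl
      obtain ⟨υ, rfl⟩ := hρ
      obtain ⟨h, hτ⟩ := hmem x (τ ++ υ) rfl
      exact ⟨h, (hT x h).tree.prefix_mem _ _ (List.prefix_append _ _) hτ⟩
    · rintro (_ | ⟨x, τ⟩) hmem
      · refine .inr ⟨by simpa using hQ, ?_⟩
        convert hB using 1
        ext x
        constructor
        · intro hx
          exact (hx x [] rfl).1
        · rintro hx _ _ ⟨⟩
          exact ⟨hx, (hT x hx).tree.root_mem⟩
      · obtain ⟨h, hτ⟩ := hmem x τ rfl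
        rcases (hT x h).node τ hτ with ⟨hD, hl⟩ | ⟨hQ, hs⟩
        · refine .inl ⟨by simpa using hD, fun y hy => ?_⟩
          exact hl y (hy x (τ ++ [y]) rfl).2
        · refine .inr ⟨by simpa using hQ, ?_⟩
          convert hs using 1
          ext y
          constructor
          · intro hy
            exact (hy x (τ ++ [y]) rfl).2
          · rintro hy _ _ ⟨⟩
            exact ⟨h, hy⟩
    · have hx : x = fun i => Nat.casesOn i (x 0) fun i => x (i + 1) := by
        funext i
        cases i <;> rfl
      by_cases h : x 0 ∈ B
      · obtain ⟨n, hn⟩ := (hT _ h).wellFounded fun i => x (i + 1)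
        refine ⟨n + 1, fun hmem => hn ?_⟩
        rw [hx, restr_cons] at hmem
        exact (hmem _ _ rfl).2
      · refine ⟨1, fun hmem => h ?_⟩
        exact (hmem (x 0) [] rfl).1

theorem Bar.exists_tree {V : Set (Set ℕ)} {D Q : List ℕ → Prop} (h : Bar V D Q []) :
    ∃ T, IsBarTree V D Q T := by
  simpa using h.exists_tree_above

theorem IsUpperFamily.univ_mem {V : Set (Set ℕ)} (hV : IsUpperFamily V) : Set.univ ∈ V := by
  obtain ⟨A, hA⟩ := hV.nonempty
  exact hV.upward A _ hA (Set.subset_univ A)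

/-! ### Stopping functions -/

/-- A stopping function assigns outputs to finite strings, none to the empty string, and keeps an
output once it is produced. -/
structure IsStopping (φ : List ℕ → Option ℕ) : Prop where
  nil : φ [] = none
  snoc : ∀ σ y x, φ σ = some y → φ (σ ++ [x]) = some y

/-- From `σ` one can force the stopping function `φ` to produce an output in `A`. -/
abbrev Forces (V : Set (Set ℕ)) (φ : List ℕ → Option ℕ) (A : Set ℕ) : List ℕ → Prop :=
  Bar V (fun σ => ∃ y ∈ A, φ σ = some y) (fun σ => φ σ = none)

/-- A single stopping function can be forced into every member of `U`. -/
def StoppingLE (U V : Set (Set ℕ)) : Prop :=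
  ∃ φ, IsStopping φ ∧ ∀ A ∈ U, Forces V φ A []

theorem IsStopping.mono {φ : List ℕ → Option ℕ} (h : IsStopping φ) {σ τ : List ℕ} {y : ℕ}
    (hp : σ <+: τ) (hy : φ σ = some y) : φ τ = some y := by
  obtain ⟨ρ, rfl⟩ := hp
  induction ρ using List.reverseRecOn with
  | nil => simpa using hy
  | append_singleton ρ x ih => rw [← List.append_assoc]; exact h.snoc _ _ _ ih

theorem Forces.mem {V : Set (Set ℕ)} {φ : List ℕ → Option ℕ} {A : Set ℕ} {σ : List ℕ} {y : ℕ}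
    (h : Forces V φ A σ) (hy : φ σ = some y) : y ∈ A := by
  cases h with
  | reach _ h =>
    obtain ⟨z, hz, h⟩ := h
    rw [hy] at h
    cases h
    exact hz
  | ask _ B h => rw [hy] at h; cases h

theorem exists_option_of_functional {α β : Type*} (P : α → β → Prop)
    (h : ∀ {a b c}, P a b → P a c → b = c) :
    ∃ f : α → Option β, ∀ a b, f a = some b ↔ P a b := by
  classical
  refine ⟨fun a => if h : ∃ b, P a b then some h.choose else none, fun a b => ?_⟩
  by_cases hb : ∃ b, P a b
  · simp only [dif_pos hb, Option.some_inj]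
    exact ⟨fun e => e ▸ hb.choose_spec, h hb.choose_spec⟩
  · simp only [dif_neg hb, reduceCtorEq, false_iff]
    exact fun hp => hb ⟨b, hp⟩

/-- An output seen at a node of a `V`-branching tree is the value of `Φ` on some path through that
node, hence lies in `A`; every path eventually produces an output, so the tree is an invariant to
which bar induction applies. -/
theorem stoppingLE_of_gamifiedKatetovLE {U V : Set (Set ℕ)} (hV : IsUpperFamily V)
    (h : GamifiedKatetovLE U V) : StoppingLE U V := by
  obtain ⟨Φ, ⟨φ, hφ, hΦ⟩, h⟩ := h
  have hφuniq : ∀ {σ τ ρ : List ℕ} {a b : ℕ}, σ <+: ρ → τ <+: ρ → a ∈ φ σ → b ∈ φ τ → a = b := by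
    intro σ τ ρ a b hσ hτ ha hb
    rcases List.prefix_or_prefix_of_prefix hσ hτ with hp | hp
    · rw [hφ _ _ ha.1 hb.1 hp] at ha
      exact Part.mem_unique ha hb
    · rw [hφ _ _ hb.1 ha.1 hp] at hb
      exact Part.mem_unique ha hb
  -- outputs are delayed by one step so that the empty string has none
  let P : List ℕ → ℕ → Prop := fun σ y => σ ≠ [] ∧ ∃ τ, τ <+: σ ∧ y ∈ φ τ
  have huniq : ∀ {σ y z}, P σ y → P σ z → y = z := by
    rintro σ y z ⟨-, τ, hτ, hy⟩ ⟨-, τ', hτ', hz⟩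
    exact hφuniq hτ hτ' hy hz
  obtain ⟨f, hf⟩ := exists_option_of_functional P @huniq
  refine ⟨f, ⟨?_, ?_⟩, fun A hA => ?_⟩
  · rw [Option.eq_none_iff_forall_not_mem]
    intro y hy
    exact ((hf _ _).1 hy).1 rfl
  · intro σ y x hy
    obtain ⟨hne, τ, hτ, hm⟩ := (hf _ _).1 hy
    exact (hf _ _).2 ⟨by simp, τ, hτ.trans (List.prefix_append _ _), hm⟩
  · obtain ⟨T, hT, hdom, hmem⟩ := h A hA
    have hsome : ∀ σ ∈ T, ∀ y, f σ = some y → y ∈ A := by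
      intro σ hσ y hy
      obtain ⟨-, τ, hτ, hm⟩ := (hf _ _).1 hy
      -- Nodes extend to paths because `∅ ∉ V`.
      obtain ⟨x, hx, hxT⟩ := exists_path_of_serial (· ∈ T) σ hσ (by
        intro τ hτ
        by_contra hne
        push Not at hne
        have : succs T τ = ∅ := Set.eq_empty_of_forall_notMem hne
        exact hV.empty_notMem (this ▸ hT.branching τ hτ))
      have hxp : x ∈ paths T := by
        intro n
        rcases le_total σ.length n with hn | hn
        · exact hxT n hn
        · exact hT.tree.prefix_mem _ _ (restr_prefix x hn) (hxT _ le_rfl)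
      refine hmem x hxp y ((hΦ x y).2 ⟨τ.length, ?_⟩)
      have : restr x τ.length = τ := by
        refine List.IsPrefix.eq_of_length (List.prefix_of_prefix_length_le
          (hx ▸ restr_prefix x hτ.length_le) hτ (by simp [length_restr])) (by simp [length_restr])
      rwa [this]
    refine Bar.of_invariant (P := (· ∈ T)) hT.tree.root_mem ?_ ?_
    · intro σ hσ
      cases hc : f σ with
      | some y => exact .inl ⟨y, hsome σ hσ y hc, rfl⟩
      | none => exact .inr ⟨rfl, succs T σ, hT.branching σ hσ, fun x hx => hx⟩
    · intro x hx
      obtain ⟨n, hn⟩ := (hΦ x _).1 (Part.get_mem (hdom hx))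
      refine ⟨n + 1, _, hmem x hx _ (Part.get_mem (hdom hx)), ?_⟩
      exact (hf _ _).2 ⟨by simp [restr_succ], _, restr_prefix x n.le_succ, hn⟩

/-- The well-founded bar tree has no paths, so it is continued beyond its leaves by all strings,
which is allowed since `Set.univ ∈ V`. The output at the leaf persists along every continuation. -/
theorem gamifiedKatetovLE_of_stoppingLE {U V : Set (Set ℕ)} (hV : IsUpperFamily V)
    (h : StoppingLE U V) : GamifiedKatetovLE U V := by
  obtain ⟨φ, hφ, h⟩ := h
  have huniq : ∀ {x : ℕ → ℕ} {m n : ℕ} {a b : ℕ}, φ (restr x m) = some a →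
      φ (restr x n) = some b → a = b := by
    intro x m n a b ha hb
    rcases le_total m n with h | h
    · have := hφ.mono (restr_prefix x h) ha
      exact Option.some_inj.1 (this.symm.trans hb)
    · have := hφ.mono (restr_prefix x h) hb
      exact Option.some_inj.1 (ha.symm.trans this)
  refine ⟨fun x => ⟨∃ y n, φ (restr x n) = some y, fun h => h.choose⟩,
    ⟨fun σ => Part.ofOption (φ σ), ?_, ?_⟩, fun A hA => ?_⟩
  · intro σ τ hσ hτ hp
    simp only [Part.ofOption_dom, Option.isSome_iff_exists] at hσ
    obtain ⟨y, hy⟩ := hσ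
    simp only [hy, hφ.mono hp hy]
  · intro x c
    simp only [Part.mem_mk_iff, Part.mem_ofOption, Option.mem_def]
    constructor
    · rintro ⟨hd, rfl⟩
      exact hd.choose_spec
    · rintro ⟨n, hn⟩
      refine ⟨⟨c, n, hn⟩, ?_⟩
      generalize_proofs hd
      obtain ⟨m, hm⟩ := hd.choose_spec
      exact huniq hm hn
  · obtain ⟨T, hT⟩ := (h A hA).exists_tree
    have hout : ∀ x ∈ paths {σ | σ ∈ T ∨ ∃ ρ ∈ T, ρ <+: σ ∧ ∃ y ∈ A, φ ρ = some y},
        ∃ n, ∃ y ∈ A, φ (restr x n) = some y := by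
      intro x hx
      obtain ⟨n, hn⟩ := hT.wellFounded x
      rcases hx n with h | ⟨ρ, -, hρ, y, hy, hφy⟩
      · exact absurd h hn
      · exact ⟨n, y, hy, hφ.mono hρ hφy⟩
    refine ⟨{σ | σ ∈ T ∨ ∃ ρ ∈ T, ρ <+: σ ∧ ∃ y ∈ A, φ ρ = some y}, ⟨⟨.inl hT.tree.root_mem, ?_⟩,
      ?_⟩, ?_, ?_⟩
    · rintro σ τ hτ (hσ | ⟨ρ, hρ, hρσ, y, hy⟩)
      · exact .inl (hT.tree.prefix_mem _ _ hτ hσ)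
      · rcases List.prefix_or_prefix_of_prefix hρσ hτ with h | h
        · exact .inr ⟨ρ, hρ, h, y, hy⟩
        · exact .inl (hT.tree.prefix_mem _ _ h hρ)
    · have hext : ∀ σ, (∃ ρ ∈ T, ρ <+: σ ∧ ∃ y ∈ A, φ ρ = some y) →
          succs {σ | σ ∈ T ∨ ∃ ρ ∈ T, ρ <+: σ ∧ ∃ y ∈ A, φ ρ = some y} σ ∈ V := by
        rintro σ ⟨ρ, hρ, hρσ, hy⟩
        exact hV.upward _ _ hV.univ_mem fun x _ =>
          .inr ⟨ρ, hρ, hρσ.trans (List.prefix_append _ _), hy⟩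
      rintro σ (hσ | hσ)
      · rcases hT.node σ hσ with ⟨hD, -⟩ | ⟨-, hs⟩
        · exact hext σ ⟨σ, hσ, List.prefix_rfl, hD⟩
        · exact hV.upward _ _ hs fun x hx => .inl hx
      · exact hext σ hσ
    · intro x hx
      obtain ⟨n, y, -, hy⟩ := hout x hx
      exact ⟨y, n, hy⟩
    · intro x hx c hc
      obtain ⟨n, y, hyA, hy⟩ := hout x hx
      obtain ⟨hd, rfl⟩ := (Part.mem_mk_iff).1 hc
      obtain ⟨m, hm⟩ := hd.choose_spec
      rwa [huniq hm hy]

/-! ### Fences -/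

theorem stoppingLE_of_fence {U V : Set (Set ℕ)} {δ : Set (List ℕ)} (hδ : IsFence V δ)
    (h : KatetovLE U (deltaFubini V δ)) (hV : IsUpperFamily V) : StoppingLE U V := by
  obtain ⟨g, hg⟩ := h
  -- a dummy first query keeps the empty string without output
  let P : List ℕ → ℕ → Prop := fun σ y =>
    σ ≠ [] ∧ ∃ τ, τ <+: σ.tail ∧ τ ∈ δ ∧ y = g (Encodable.encode τ)
  have huniq : ∀ {σ y z}, P σ y → P σ z → y = z := by
    rintro σ y z ⟨-, τ, hτ, hd, rfl⟩ ⟨-, τ', hτ', hd', rfl⟩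
    rcases List.prefix_or_prefix_of_prefix hτ hτ' with hp | hp
    · rw [hδ.antichain _ hd _ hd' hp]
    · rw [hδ.antichain _ hd' _ hd hp]
  obtain ⟨f, hf⟩ := exists_option_of_functional P @huniq
  have hnil : f [] = none := by
    rw [Option.eq_none_iff_forall_not_mem]
    intro y hy
    exact ((hf _ _).1 hy).1 rfl
  refine ⟨f, ⟨hnil, ?_⟩, fun A hA => ?_⟩
  · intro σ y x hy
    obtain ⟨hne, τ, hτ, hy⟩ := (hf _ _).1 hy
    refine (hf _ _).2 ⟨by simp, τ, ?_, hy⟩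
    rw [List.tail_append_of_ne_nil hne]
    exact hτ.trans (List.prefix_append _ _)
  · obtain ⟨_, ⟨T, hT, rfl⟩, hTA⟩ := hg A hA
    -- The answer to the dummy query is dropped, so the play on `T` is the tail.
    refine Bar.of_invariant (P := fun σ => σ.tail ∈ T) hT.tree.root_mem ?_ ?_
    · intro σ hσ
      cases hc : f σ with
      | some y =>
        obtain ⟨-, τ, hτ, hd, rfl⟩ := (hf _ _).1 hc
        exact .inl ⟨_, hTA ⟨τ, ⟨hT.tree.prefix_mem _ _ hτ hσ, hd⟩, rfl⟩, rfl⟩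
      | none =>
        refine .inr ⟨rfl, ?_⟩
        by_cases hne : σ = []
        · subst hne
          exact ⟨_, hV.univ_mem, fun x _ => hT.tree.root_mem⟩
        · rcases hT.branching _ hσ with hd | hs
          · have := (hf σ _).2 ⟨hne, _, List.prefix_rfl, hd, rfl⟩
            rw [hc] at this
            cases this
          · refine ⟨_, hs, fun x hx => ?_⟩
            rw [List.tail_append_of_ne_nil hne]
            exact hx
    · intro x hx
      have ht := tail_restr_succ x
      obtain ⟨n, hn⟩ := hT.meets (fun i => x (i + 1)) fun n => ht n ▸ hx (n + 1)
      refine ⟨n + 1, g (Encodable.encode (restr (fun i => x (i + 1)) n)), ?_, ?_⟩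
      · exact hTA ⟨_, ⟨ht n ▸ hx (n + 1), hn⟩, rfl⟩
      · refine (hf _ _).2 ⟨by simp [restr_succ], _, ?_, hn, rfl⟩
        rw [ht]

/-- The fence consists of the minimal strings with an output. It depends on `φ` alone, so the same
fence serves every `A ∈ U`, and the Katetov map reads the output off the code. -/
theorem exists_fence_of_stoppingLE {U V : Set (Set ℕ)} (hU : IsUpperFamily U)
    (h : StoppingLE U V) : ∃ δ, IsFence V δ ∧ KatetovLE U (deltaFubini V δ) := by
  obtain ⟨φ, hφ, h⟩ := h
  have key : ∀ A ∈ U, ∃ T, IsBranchingUpTo V {σ | φ σ ≠ none ∧ φ σ.dropLast = none} T ∧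
      ∀ σ ∈ T, ∀ y, φ σ = some y → y ∈ A := by
    intro A hA
    obtain ⟨T, hT⟩ := (h A hA).exists_tree
    refine ⟨T, ⟨hT.tree, ?_, ?_⟩, ?_⟩
    · intro x hx
      obtain ⟨n, hn⟩ := hT.wellFounded x
      exact absurd (hx n) hn
    · intro σ hσ
      rcases hT.node σ hσ with ⟨⟨y, -, hy⟩, -⟩ | ⟨-, hs⟩
      · refine .inl ⟨by simp [hy], ?_⟩
        -- The parent of a leaf is an inner node, hence has no output, so the leaf is minimal.
        rcases List.eq_nil_or_concat' σ with rfl | ⟨ρ, x, rfl⟩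
        · exact hφ.nil
        · rw [List.dropLast_concat]
          rcases hT.node ρ (hT.tree.prefix_mem _ _ (List.prefix_append _ _) hσ) with
            ⟨-, hl⟩ | ⟨hQ, -⟩
          · exact absurd hσ (hl x)
          · exact hQ
      · exact .inr hs
    · intro σ hσ y hy
      rcases hT.node σ hσ with ⟨⟨z, hz, hzφ⟩, -⟩ | ⟨hQ, -⟩
      · rw [hy, Option.some_inj] at hzφ
        rwa [hzφ]
      · rw [hy] at hQ
        cases hQ
  refine ⟨{σ | φ σ ≠ none ∧ φ σ.dropLast = none}, ⟨?_, ?_⟩,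
    fun n => ((Encodable.decode (α := List ℕ) n).bind φ).getD 0, ?_⟩
  · rintro σ ⟨hσ, -⟩ τ ⟨-, hτ⟩ hp
    by_contra hne
    obtain ⟨y, hy⟩ := Option.ne_none_iff_exists'.1 hσ
    rw [hφ.mono (prefix_dropLast_of_ne hp hne) hy] at hτ
    cases hτ
  · obtain ⟨A, hA⟩ := hU.nonempty
    obtain ⟨T, hT, -⟩ := key A hA
    exact ⟨T, hT⟩
  · intro A hA
    obtain ⟨T, hT, hTA⟩ := key A hA
    refine ⟨_, ⟨T, hT, rfl⟩, ?_⟩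
    rintro _ ⟨σ, ⟨hσ, hne, -⟩, rfl⟩
    obtain ⟨y, hy⟩ := Option.ne_none_iff_exists'.1 hne
    simpa [hy] using hTA σ hσ y hy

/-! ### Composition, Fubini squares and the Katetov order -/

theorem StoppingLE.of_katetovLE {U V : Set (Set ℕ)} (h : KatetovLE U V) : StoppingLE U V := by
  obtain ⟨g, hg⟩ := h
  refine ⟨fun σ => σ.head?.map g, ⟨rfl, ?_⟩, fun A hA => ?_⟩
  · rintro (_ | ⟨a, σ⟩) y x h
    · cases h
    · exact h
  · exact .ask _ _ rfl (hg A hA) fun x hx => .reach _ ⟨g x, hx, rfl⟩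

/-- One step of the parsing of a string into blocks, each a minimal string with an output
under `χ`: a state is the list of the outputs so far and the current unfinished block. -/
def parseStep (χ : List ℕ → Option ℕ) (s : List ℕ × List ℕ) (x : ℕ) : List ℕ × List ℕ :=
  match χ (s.2 ++ [x]) with
  | none => (s.1, s.2 ++ [x])
  | some y => (s.1 ++ [y], [])

/-- Each query of `φ` to `V` is answered by a complete run of `χ` against `W`. The outer induction
follows the bar of `φ` along the parsed outputs `α`, the inner one the bar of `χ` along the current
block `κ`. -/
theorem StoppingLE.trans {U V W : Set (Set ℕ)} (h₁ : StoppingLE U V) (h₂ : StoppingLE V W) :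
    StoppingLE U W := by
  obtain ⟨φ, hφ, hU⟩ := h₁
  obtain ⟨χ, hχ, hV⟩ := h₂
  let s : List ℕ → List ℕ × List ℕ := List.foldl (parseStep χ) ([], [])
  have hs : ∀ σ x, s (σ ++ [x]) = parseStep χ (s σ) x := by
    intro σ x
    simp [s]
  refine ⟨fun σ => φ (s σ).1, ⟨hφ.nil, ?_⟩, fun A hA => ?_⟩
  · intro σ y x hy
    refine hφ.mono ?_ hy
    rw [hs, parseStep]
    split
    · exact List.prefix_rfl
    · exact List.prefix_append _ _
  · have outer : ∀ α, Forces V φ A α → ∀ σ, s σ = (α, []) →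
        Forces W (fun σ => φ (s σ).1) A σ := by
      intro α hα
      induction hα with
      | reach α h =>
        intro σ hσ
        refine .reach _ ?_
        simpa only [hσ] using h
      | ask α B hα hB _ ih =>
        have inner : ∀ κ, Forces W χ B κ → χ κ = none → ∀ σ, s σ = (α, κ) →
            Forces W (fun σ => φ (s σ).1) A σ := by
          intro κ hκ
          induction hκ with
          | reach κ h =>
            intro hn
            obtain ⟨y, -, hy⟩ := h
            rw [hn] at hy
            cases hy
          | ask κ C hκ hC hx ih' =>
            intro _ σ hσ
            refine .ask _ C (by simpa [hσ] using hα) hC fun x hxC => ?_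
            have hstep := hs σ x
            rw [hσ, parseStep] at hstep
            cases hc : χ (κ ++ [x]) with
            | none =>
              simp only [hc] at hstep
              exact ih' x hxC hc _ hstep
            -- The finished block yields a legal answer `y ∈ B` for `φ`, so the outer hypothesis
            -- takes over with an empty block.
            | some y =>
              simp only [hc] at hstep
              exact ih y (Forces.mem (hx x hxC) hc) _ hstep
        intro σ hσ
        exact inner [] (hV B hB) hχ.nil σ hσ
    exact outer [] (hU A hA) [] rfl

theorem IsUpperFamily.fubini {U V : Set (Set ℕ)} (hU : IsUpperFamily U) (hV : IsUpperFamily V) :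
    IsUpperFamily (fubini U V) where
  upward A B hA hAB := hU.upward _ _ hA fun _ hm => hV.upward _ _ hm fun _ hl => hAB hl
  nonempty := ⟨Set.univ, by simp [GamKat.fubini, hV.univ_mem, hU.univ_mem]⟩
  empty_notMem h := hU.empty_notMem (by simpa [GamKat.fubini, hV.empty_notMem] using h)

theorem katetovLE_fubini {U V : Set (Set ℕ)} (hU : IsUpperFamily U)
    (hV : IsUpperFamily V) : KatetovLE U (fubini U V) := by
  refine ⟨fun n => n.unpair.1, fun A hA => hU.upward A _ hA fun m hm => ?_⟩
  have : {l : ℕ | Nat.pair m l ∈ (fun n => n.unpair.1) ⁻¹' A} = Set.univ := by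
    ext l
    simpa using hm
  simpa only [Set.mem_ofPred_eq, this] using hV.univ_mem

theorem stoppingLE_fubini_self (U : Set (Set ℕ)) : StoppingLE (fubini U U) U := by
  refine ⟨fun σ => match σ with
    | a :: b :: _ => some (Nat.pair a b)
    | _ => none, ⟨rfl, ?_⟩, fun A hA => ?_⟩
  · rintro (_ | ⟨a, _ | ⟨b, σ⟩⟩) y x h
    · cases h
    · cases h
    · exact h
  · exact .ask _ _ rfl hA fun m hm => .ask _ _ rfl hm fun l hl => .reach _ ⟨_, hl, rfl⟩

theorem RudinKeislerLE.katetovLE {U V : Set (Set ℕ)} (h : RudinKeislerLE U V) : KatetovLE U V := by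
  obtain ⟨g, hg⟩ := h
  exact ⟨g, fun A hA => (hg A).1 hA⟩

/-- The family of cofinite sets. -/
def cofiniteFamily : Set (Set ℕ) :=
  {A | Aᶜ.Finite}

theorem isUpperFamily_cofiniteFamily : IsUpperFamily cofiniteFamily where
  upward _ _ hA hAB := hA.subset (Set.compl_subset_compl.2 hAB)
  nonempty := ⟨Set.univ, by simp [cofiniteFamily]⟩
  empty_notMem h := Set.infinite_univ (by simpa [cofiniteFamily] using h)

/-- If `g` sends infinitely many points into one column, the complement of that column has a
preimage that is not cofinite. Otherwise the range of `g` meets each column in a finite set, so its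
complement lies in the Fubini square but has empty preimage. -/
theorem not_katetovLE_fubini_cofiniteFamily :
    ¬ KatetovLE (fubini cofiniteFamily cofiniteFamily) cofiniteFamily := by
  rintro ⟨g, hg⟩
  by_cases h : ∃ m, {n | (g n).unpair.1 = m}.Infinite
  · obtain ⟨m, hm⟩ := h
    refine hm (Set.Finite.subset (hg {k | k.unpair.1 ≠ m} ?_) ?_)
    · refine (Set.finite_singleton m).subset fun i hi => ?_
      by_contra hne
      refine hi ?_
      have : {l : ℕ | Nat.pair i l ∈ {k : ℕ | k.unpair.1 ≠ m}} = Set.univ := by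
        ext l
        simpa using hne
      show {l : ℕ | Nat.pair i l ∈ {k : ℕ | k.unpair.1 ≠ m}} ∈ cofiniteFamily
      rw [this]
      exact isUpperFamily_cofiniteFamily.univ_mem
    · intro n hn
      simpa using hn
  · push Not at h
    refine isUpperFamily_cofiniteFamily.empty_notMem ?_
    have : g ⁻¹' (Set.range g)ᶜ = ∅ := by
      ext n
      simp
    rw [← this]
    refine hg _ (isUpperFamily_cofiniteFamily.upward _ _
      isUpperFamily_cofiniteFamily.univ_mem fun m _ => ?_)
    refine ((h m).image fun n => (g n).unpair.2).subset ?_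
    intro l hl
    simp only [Set.mem_compl_iff, Set.mem_ofPred_eq, not_not, Set.mem_range] at hl
    obtain ⟨n, hn⟩ := hl
    exact ⟨n, by simp [hn], by simp [hn]⟩

/-! ### The game -/

theorem pair_one_ne_zero (y : ℕ) : Nat.pair 1 y ≠ 0 := by
  intro h
  have : (Nat.pair 1 y).unpair.1 = 1 := by simp
  rw [h] at this
  simp at this

/-- Player II₁ plays the successor sets of a bar tree chosen for `A`; every legal position then
stays in that tree, whose nodes give the legality conditions and whose well-foundedness gives
termination. -/
theorem IsDecisionStrategy.exists_isWinningStrategy {U V : Set (Set ℕ)} {ψ : List ℕ →. ℕ}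
    (hψ : IsDecisionStrategy ψ)
    (h : ∀ A ∈ U, Bar V (fun σ => ∃ y ∈ A, Nat.pair 1 y ∈ ψ σ) (fun σ => 0 ∈ ψ σ) []) :
    ∃ η, IsWinningStrategy U V ψ η := by
  classical
  have hT : ∀ A, ∃ T, A ∈ U →
      IsBarTree V (fun σ => ∃ y ∈ A, Nat.pair 1 y ∈ ψ σ) (fun σ => 0 ∈ ψ σ) T := by
    intro A
    by_cases hA : A ∈ U
    · obtain ⟨T, hT⟩ := (h A hA).exists_tree
      exact ⟨T, fun _ => hT⟩
    · exact ⟨∅, fun h => absurd h hA⟩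
  choose T hT using hT
  have hpos : ∀ A ∈ U, ∀ σ, GamePosition ψ (fun p => Part.some (succs (T p.1) p.2)) A σ →
      σ ∈ T A := by
    intro A hA σ hσ
    induction hσ with
    | nil => exact (hT A hA).tree.root_mem
    | snoc σ B x _ _ hB hx _ =>
      rw [Part.mem_some_iff] at hB
      subst hB
      exact hx
  refine ⟨fun p => Part.some (succs (T p.1) p.2), hψ, ?_, ?_, ?_, ?_⟩
  · intro A hA σ hσ
    rcases (hT A hA).node σ (hpos A hA σ hσ) with ⟨⟨y, -, hy⟩, -⟩ | ⟨h0, -⟩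
    · exact hy.1
    · exact h0.1
  · intro A hA σ hσ h0
    refine ⟨_, Part.mem_some _, ?_⟩
    rcases (hT A hA).node σ (hpos A hA σ hσ) with ⟨⟨y, -, hy⟩, -⟩ | ⟨-, hs⟩
    · exact absurd (Part.mem_unique hy h0) (pair_one_ne_zero y)
    · exact hs
  · intro A hA σ hσ y hy
    rcases (hT A hA).node σ (hpos A hA σ hσ) with ⟨⟨z, hz, hzψ⟩, -⟩ | ⟨h0, -⟩
    · have := Part.mem_unique hy hzψ
      rw [Nat.pair_eq_pair] at this
      rwa [this.2]
    · exact absurd (Part.mem_unique hy h0) (pair_one_ne_zero y)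
  · intro A hA x
    obtain ⟨n, hn⟩ := (hT A hA).wellFounded x
    exact ⟨n, fun h => hn (hpos A hA _ h)⟩

theorem stoppingLE_of_playerIIWins {U V : Set (Set ℕ)} (h : PlayerIIWins U V) :
    StoppingLE U V := by
  obtain ⟨ψ, η, h⟩ := h
  -- Outputs are made to persist; `halted` ensures that at most one prefix declares an output.
  let P : List ℕ → ℕ → Prop := fun σ y => ∃ τ, τ <+: σ ∧ Nat.pair 1 y ∈ ψ τ
  have huniq : ∀ {σ y z}, P σ y → P σ z → y = z := by
    rintro σ y z ⟨τ, hτ, hy⟩ ⟨τ', hτ', hz⟩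
    have : τ = τ' := by
      rcases List.prefix_or_prefix_of_prefix hτ hτ' with hp | hp
      · by_contra hne
        exact h.decision.halted _ _ _ hy hp hne hz.1
      · by_contra hne
        exact h.decision.halted _ _ _ hz hp (Ne.symm hne) hy.1
    subst this
    exact (Nat.pair_eq_pair.1 (Part.mem_unique hy hz)).2
  obtain ⟨f, hf⟩ := exists_option_of_functional P @huniq
  refine ⟨f, ⟨?_, ?_⟩, fun A hA => ?_⟩
  · rw [Option.eq_none_iff_forall_not_mem]
    intro y hy
    obtain ⟨τ, hτ, hy'⟩ := (hf _ _).1 hy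
    rw [List.prefix_nil.1 hτ] at hy'
    exact pair_one_ne_zero y (Part.mem_unique hy' h.decision.start)
  · intro σ y x hy
    obtain ⟨τ, hτ, hy⟩ := (hf _ _).1 hy
    exact (hf _ _).2 ⟨τ, hτ.trans (List.prefix_append _ _), hy⟩
  · refine Bar.of_invariant (P := GamePosition ψ η A) .nil ?_ ?_
    · intro σ hσ
      have hd := h.moves A hA σ hσ
      rcases h.decision.legal σ _ (Part.get_mem hd) with h0 | ⟨y, hy⟩
      · have h0 : 0 ∈ ψ σ := h0 ▸ Part.get_mem hd
        obtain ⟨B, hB, hBV⟩ := h.query A hA σ hσ h0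
        refine .inr ⟨?_, B, hBV, fun x hx => .snoc σ B x hσ h0 hB hx⟩
        rw [Option.eq_none_iff_forall_not_mem]
        intro y hy
        obtain ⟨τ, hτ, hy'⟩ := (hf _ _).1 hy
        by_cases hne : τ = σ
        · subst hne
          exact pair_one_ne_zero y (Part.mem_unique hy' h0)
        · exact h.decision.halted _ _ _ hy' hτ hne hd
      · have hy : Nat.pair 1 y ∈ ψ σ := hy ▸ Part.get_mem hd
        exact .inl ⟨y, h.valid A hA σ hσ y hy, (hf _ _).2 ⟨σ, List.prefix_rfl, hy⟩⟩
    · intro x hx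
      obtain ⟨n, hn⟩ := h.terminates A hA x
      exact absurd (hx n) hn

theorem playerIIWins_of_stoppingLE {U V : Set (Set ℕ)} (h : StoppingLE U V) :
    PlayerIIWins U V := by
  classical
  obtain ⟨φ, hφ, h⟩ := h
  -- The output is declared only where it first appears; beyond that `ψ` must be undefined, as
  -- `halted` demands.
  let ψ : List ℕ →. ℕ := fun σ => match φ σ with
    | none => Part.some 0
    | some y => if φ σ.dropLast = none then Part.some (Nat.pair 1 y) else Part.none
  have h0 : ∀ σ, φ σ = none → 0 ∈ ψ σ := by
    intro σ h
    simp [ψ, h]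
  have h1 : ∀ σ v, v ∈ ψ σ → (φ σ = none ∧ v = 0) ∨
      ∃ y, φ σ = some y ∧ φ σ.dropLast = none ∧ v = Nat.pair 1 y := by
    intro σ v hv
    simp only [ψ] at hv
    split at hv
    · exact .inl ⟨by assumption, by simpa using hv⟩
    · split_ifs at hv with hd
      · exact .inr ⟨_, by assumption, hd, by simpa using hv⟩
      · simp at hv
  have h2 : ∀ σ y, φ σ = some y → φ σ.dropLast = none → Nat.pair 1 y ∈ ψ σ := by
    intro σ y hy hd
    simp [ψ, hy, hd]
  have hψ : IsDecisionStrategy ψ := by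
    refine ⟨h0 _ hφ.nil, ?_, ?_⟩
    · intro σ v hv
      rcases h1 σ v hv with ⟨-, h⟩ | ⟨y, -, -, h⟩
      · exact .inl h
      · exact .inr ⟨y, h⟩
    · intro σ y τ hy hp hne hd
      rcases h1 σ _ hy with ⟨-, h⟩ | ⟨z, hz, -, -⟩
      · exact pair_one_ne_zero y h
      · have ht := hφ.mono (prefix_dropLast_of_ne hp hne) hz
        rcases h1 τ _ (Part.get_mem hd) with ⟨h, -⟩ | ⟨w, -, h, -⟩
        · rw [hφ.mono hp hz] at h
          cases h
        · rw [ht] at h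
          cases h
  obtain ⟨η, hη⟩ := hψ.exists_isWinningStrategy (U := U) (V := V) (by
    intro A hA
    obtain ⟨T, hT⟩ := (h A hA).exists_tree
    refine Bar.of_invariant (P := (· ∈ T)) hT.tree.root_mem ?_ ?_
    · intro σ hσ
      rcases hT.node σ hσ with ⟨⟨y, hyA, hy⟩, -⟩ | ⟨hQ, hs⟩
      · refine .inl ⟨y, hyA, h2 σ y hy ?_⟩
        rcases List.eq_nil_or_concat' σ with rfl | ⟨ρ, x, rfl⟩
        · exact hφ.nil
        · rw [List.dropLast_concat]
          rcases hT.node ρ (hT.tree.prefix_mem _ _ (List.prefix_append _ _) hσ) with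
            ⟨-, hl⟩ | ⟨hQ, -⟩
          · exact absurd hσ (hl x)
          · exact hQ
      · exact .inr ⟨h0 σ hQ, _, hs, fun x hx => hx⟩
    · intro x hx
      obtain ⟨n, hn⟩ := hT.wellFounded x
      exact absurd (hx n) hn)
  exact ⟨ψ, η, hη⟩

/-! ### Indices of partial computable functions -/

theorem partrec₂_pcf : Partrec₂ pcf :=
  Nat.Partrec.Code.eval_part.comp₂ ((Computable.ofNat _).comp Computable.fst).to₂
    Computable.snd.to₂

theorem exists_pcf_eq {f : ℕ →. ℕ} (hf : Partrec f) : ∃ e, pcf e = f := by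
  obtain ⟨c, hc⟩ := Nat.Partrec.Code.exists_code.1 (Partrec.nat_iff.1 hf)
  exact ⟨Encodable.encode c, by simp [pcf, hc]⟩

/-- Parametrised indices of a uniformly partial computable family. -/
theorem exists_computable_pcf_eq {α : Type*} [Primcodable α] {f : α → ℕ →. ℕ} (hf : Partrec₂ f) :
    ∃ g : α → ℕ, Computable g ∧ ∀ a, pcf (g a) = f a := by
  obtain ⟨c, hc⟩ := Nat.Partrec.Code.exists_code.1 hf
  refine ⟨fun a => Encodable.encode (c.curry (Encodable.encode a)), ?_, fun a => ?_⟩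
  · exact Computable.encode.comp ((Nat.Partrec.Code.primrec₂_curry.to_comp).comp
      (Computable.const c) Computable.encode)
  · funext x
    have : Nat.pair (Encodable.encode a) x = Encodable.encode (a, x) := rfl
    simp [pcf, Nat.Partrec.Code.eval_curry, hc, this, -Encodable.encode_prod_val]
    exact Part.map_id' (fun _ => rfl) _

/-- The recursion theorem. -/
theorem exists_pcf_fixed_point {α : Type*} [Primcodable α] {F : ℕ → α →. ℕ} (hF : Partrec₂ F) :
    ∃ e, ∀ a, pcf e (Encodable.encode a) = F e a := by
  obtain ⟨c, hc⟩ := Nat.Partrec.Code.fixed_point₂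
    (f := fun c n => (Part.ofOption (Encodable.decode (α := α) n)).bind
      fun a => F (Encodable.encode c) a) (by
    refine Partrec.bind (Computable.ofOption (Computable.decode.comp Computable.snd)) ?_
    exact hF.comp₂ ((Computable.encode.comp (Computable.fst.comp Computable.fst)).to₂)
      Computable.snd.to₂)
  exact ⟨Encodable.encode c, fun a => by simp [pcf, hc]⟩

/-- The fold is a recursion on the number of entries consumed; the default entry is never read,
since indices stay below the length. -/
theorem partrec_foldl {α : Type*} [Primcodable α] {f : ℕ → α →. ℕ} (hf : Partrec₂ f) (a : ℕ)
    [Inhabited α] :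
    Partrec fun l : List α => l.foldl (fun p x => p.bind fun v => f v x) (Part.some a) := by
  have h : Partrec fun l : List α => (Nat.rec (motive := fun _ => Part ℕ) (Part.some a)
      (fun k p => p.bind fun v => f v (l.getD k default)) l.length) :=
    Partrec.nat_rec (g := fun _ => Part.some a)
      (h := fun (l : List α) (q : ℕ × ℕ) => f q.2 (l.getD q.1 default)) Computable.list_length
      (Computable.const a).partrec
      (hf.comp₂ (Computable.snd.comp Computable.snd).to₂
        ((Primrec.list_getD default).to_comp.comp Computable.fst
          (Computable.fst.comp Computable.snd)).to₂)
  have key : ∀ (l : List α), ∀ k ≤ l.length, (Nat.rec (motive := fun _ => Part ℕ) (Part.some a)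
      (fun k p => p.bind fun v => f v (l.getD k default)) k) =
      (l.take k).foldl (fun p x => p.bind fun v => f v x) (Part.some a) := by
    intro l k hk
    induction k with
    | zero => rfl
    | succ k ih =>
      have hk' : k < l.length := hk
      rw [List.take_succ_eq_append_getElem hk', List.foldl_append, ← ih hk'.le]
      simp only [List.getD_eq_getElem _ _ hk', List.foldl_cons, List.foldl_nil]
  exact h.of_eq fun l => (key l l.length le_rfl).trans (by rw [List.take_length])

/-! ### Basic topologies -/

theorem pair_zero_mem_basicTopology (U : Set (Set ℕ)) {p : Set ℕ} {a : ℕ} (ha : a ∈ p) :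
    Nat.pair 0 a ∈ basicTopology U p :=
  fun _ hq => hq.1 a ha

theorem pair_one_mem_basicTopology {U : Set (Set ℕ)} {p A : Set ℕ} {b : ℕ} (hA : A ∈ U)
    (hb : b ∈ rimp A (basicTopology U p)) : Nat.pair 1 b ∈ basicTopology U p := by
  intro q hq
  refine hq.2 b (Set.mem_iUnion₂.2 ⟨A, hA, fun x hx => ?_⟩)
  obtain ⟨c, hc, hcp⟩ := hb x hx
  exact ⟨c, hc, hcp q hq⟩

theorem basicTopology_induction {U : Set (Set ℕ)} {p : Set ℕ} {P : ℕ → Prop}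
    (h0 : ∀ a ∈ p, P (Nat.pair 0 a))
    (h1 : ∀ A ∈ U, ∀ b, (∀ x ∈ A, ∃ c ∈ pcf b x, P c) → P (Nat.pair 1 b)) {n : ℕ}
    (hn : n ∈ basicTopology U p) : P n := by
  refine hn {n | P n} ⟨h0, fun b hb => ?_⟩
  obtain ⟨A, hA, hb⟩ := Set.mem_iUnion₂.1 hb
  exact h1 A hA b hb

/-- The universal property of basic topologies, uniformly in the realisers. -/
theorem exists_basicTopology_lift :
    ∃ D : ℕ × ℕ → ℕ, Computable D ∧ ∀ (U : Set (Set ℕ)) (p q : Set ℕ) (f g : ℕ),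
      f ∈ rimp p q → g ∈ rimp (genOp U q) q → D (f, g) ∈ rimp (basicTopology U p) q := by
  -- `idx (e, (f, g), b)` codes `b` followed by the recursive call to `e`.
  obtain ⟨idx, hidx, hidx_eq⟩ := exists_computable_pcf_eq
    (f := fun (r : ℕ × (ℕ × ℕ) × ℕ) x => (pcf r.2.2 x).bind fun y =>
      pcf r.1 (Encodable.encode (r.2.1, y))) (by
    refine Partrec.bind (partrec₂_pcf.comp
      (Computable.snd.comp (Computable.snd.comp Computable.fst)) Computable.snd) ?_
    exact partrec₂_pcf.comp₂ (Computable.fst.comp (Computable.fst.comp Computable.fst)).to₂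
      (Computable.encode.comp (Computable.pair
        (Computable.fst.comp (Computable.snd.comp (Computable.fst.comp Computable.fst)))
        Computable.snd)).to₂)
  -- Recursion on the strategy coded by the input: `f` treats an output (tag `0`), and `g` treats a
  -- query (tag `1`) whose continuations have already been mapped into `q`.
  obtain ⟨e, he⟩ := exists_pcf_fixed_point
    (F := fun e (r : (ℕ × ℕ) × ℕ) => bif decide (r.2.unpair.1 = 0) then pcf r.1.1 r.2.unpair.2
      else pcf r.1.2 (idx (e, r.1, r.2.unpair.2))) (by
    have hn : Computable fun r : ℕ × (ℕ × ℕ) × ℕ => r.2.2.unpair :=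
      Computable.unpair.comp (Computable.snd.comp Computable.snd)
    have hfg : Computable fun r : ℕ × (ℕ × ℕ) × ℕ => r.2.1 := Computable.fst.comp Computable.snd
    refine Partrec.cond ?_ ?_ ?_
    · exact (Primrec.eq.decide.to_comp).comp (Computable.fst.comp hn) (Computable.const 0)
    · exact partrec₂_pcf.comp (Computable.fst.comp hfg) (Computable.snd.comp hn)
    · exact partrec₂_pcf.comp (Computable.snd.comp hfg) (hidx.comp
        (Computable.pair Computable.fst (Computable.pair hfg (Computable.snd.comp hn)))))
  obtain ⟨D, hD, hD_eq⟩ := exists_computable_pcf_eq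
    (f := fun (r : ℕ × ℕ) n => pcf e (Encodable.encode (r, n)))
    (partrec₂_pcf.comp (Computable.const e) (Computable.encode))
  refine ⟨D, hD, fun U p q f g hf hg n hn => ?_⟩
  rw [hD_eq]
  refine basicTopology_induction (P := fun n => ∃ b ∈ pcf e (Encodable.encode ((f, g), n)), b ∈ q)
    ?_ ?_ hn
  · intro a ha
    rw [he]
    simpa using hf a ha
  · intro A hA b hb
    rw [he]
    have : idx (e, (f, g), b) ∈ genOp U q := by
      refine Set.mem_iUnion₂.2 ⟨A, hA, fun x hx => ?_⟩
      obtain ⟨c, hc, y, hy, hyq⟩ := hb x hx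
      rw [hidx_eq]
      exact ⟨y, Part.mem_bind_iff.2 ⟨c, hc, hy⟩, hyq⟩
    simpa using hg _ this

theorem exists_unit_basicTopology :
    ∃ e, ∀ U p, e ∈ rimp p (basicTopology U p) := by
  obtain ⟨e, he⟩ := exists_pcf_eq (f := fun n => Part.some (Nat.pair 0 n))
    ((Primrec₂.natPair.to_comp.comp (Computable.const 0) Computable.id).partrec)
  exact ⟨e, fun U p a ha =>
    ⟨_, by rw [he]; exact Part.mem_some _, pair_zero_mem_basicTopology U ha⟩⟩

theorem exists_ask_basicTopology :
    ∃ e, ∀ U p, e ∈ rimp (genOp U (basicTopology U p)) (basicTopology U p) := by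
  obtain ⟨e, he⟩ := exists_pcf_eq (f := fun n => Part.some (Nat.pair 1 n))
    ((Primrec₂.natPair.to_comp.comp (Computable.const 1) Computable.id).partrec)
  refine ⟨e, fun U p b hb => ⟨_, by rw [he]; exact Part.mem_some _, ?_⟩⟩
  obtain ⟨A, hA, hb⟩ := Set.mem_iUnion₂.1 hb
  exact pair_one_mem_basicTopology hA hb

/-- Composition of realisers, uniformly in the first one. -/
theorem exists_computable_rimp_comp (e : ℕ) :
    ∃ c : ℕ → ℕ, Computable c ∧ ∀ (p q r : Set ℕ) (f : ℕ),
      f ∈ rimp p q → e ∈ rimp q r → c f ∈ rimp p r := by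
  obtain ⟨c, hc, hc_eq⟩ := exists_computable_pcf_eq (f := fun (f : ℕ) x => (pcf f x).bind (pcf e))
    (Partrec.bind partrec₂_pcf (partrec₂_pcf.comp₂ (Computable.const e).to₂ Computable.snd.to₂))
  refine ⟨c, hc, fun p q r f hf he x hx => ?_⟩
  obtain ⟨y, hy, hyq⟩ := hf x hx
  obtain ⟨z, hz, hzr⟩ := he y hyq
  rw [hc_eq]
  exact ⟨z, Part.mem_bind_iff.2 ⟨y, hy, hz⟩, hzr⟩

theorem LTLE.trans {j k l : Set ℕ → Set ℕ} (h₁ : LTLE j k) (h₂ : LTLE k l) : LTLE j l := by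
  obtain ⟨e, he⟩ := h₁
  obtain ⟨d, hd⟩ := h₂
  obtain ⟨c, -, hc⟩ := exists_computable_rimp_comp d
  exact ⟨c e, fun p => hc _ _ _ _ (he p) (hd p)⟩

theorem exists_id_rimp : ∃ e, ∀ p, e ∈ rimp p p := by
  obtain ⟨e, he⟩ := exists_pcf_eq (f := fun n => Part.some n) Computable.id.partrec
  exact ⟨e, fun p a ha => ⟨a, by rw [he]; exact Part.mem_some _, ha⟩⟩

/-- Monotonicity and `j(j(p)) → j(p)` are both lifts into a basic topology, along a realiser
followed by the unit and along the identity respectively. -/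
theorem isLTTopology_basicTopology (U : Set (Set ℕ)) : IsLTTopology (basicTopology U) := by
  obtain ⟨D, hD, hD_lift⟩ := exists_basicTopology_lift
  obtain ⟨u, hu⟩ := exists_unit_basicTopology
  obtain ⟨k, hk⟩ := exists_ask_basicTopology
  obtain ⟨i, hi⟩ := exists_id_rimp
  obtain ⟨c, hc, hcu⟩ := exists_computable_rimp_comp u
  refine ⟨?_, ⟨u, hu U⟩, ⟨D (i, k), fun p => hD_lift _ _ _ _ _ (hi _) (hk _ _)⟩,
    ⟨u, fun p => hu U _⟩⟩
  obtain ⟨e, he⟩ := exists_pcf_eq (f := fun f => Part.some (D (c f, k)))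
    (hD.comp (Computable.pair hc (Computable.const k))).partrec
  exact ⟨e, fun p q f hf => ⟨_, by rw [he]; exact Part.mem_some _,
    hD_lift _ _ _ _ _ (hcu _ _ _ _ hf (hu U q)) (hk U q)⟩⟩

theorem isLeastLTTopologyAbove_basicTopology (U : Set (Set ℕ)) :
    IsLeastLTTopologyAbove (genOp U) (basicTopology U) where
  topology := isLTTopology_basicTopology U
  above := by
    obtain ⟨u, hu⟩ := exists_unit_basicTopology
    obtain ⟨k, hk⟩ := exists_ask_basicTopology
    obtain ⟨c, hc, hcu⟩ := exists_computable_rimp_comp u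
    obtain ⟨e, he⟩ := exists_pcf_eq (f := fun f => pcf k (c f))
      (partrec₂_pcf.comp (Computable.const k) hc)
    refine ⟨e, fun p f hf => ?_⟩
    rw [he]
    obtain ⟨A, hA, hf⟩ := Set.mem_iUnion₂.1 hf
    exact hk U p _ (Set.mem_iUnion₂.2 ⟨A, hA, hcu _ _ _ _ hf (hu U p)⟩)
  least := by
    rintro k ⟨-, ⟨u, hu⟩, ⟨m, hm⟩, -⟩ ⟨g, hg⟩
    obtain ⟨D, -, hD_lift⟩ := exists_basicTopology_lift
    obtain ⟨c, -, hc⟩ := exists_computable_rimp_comp m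
    -- The lift has target `k p`, which is closed under `genOp U` through `genOp U (k p) → k (k p) →
    -- k p`.
    exact ⟨D (u, c g), fun p => hD_lift _ _ _ _ _ (hu p) (hc _ _ _ _ (hg (k p)) (hm p))⟩

/-! ### Realisers of computable reducibility -/

/-- A single number lies in the basic topology of `V` at every member of `U`. -/
def RealizerLE (U V : Set (Set ℕ)) : Prop :=
  ∃ t, ∀ A ∈ U, t ∈ basicTopology V A

/-- An index `i` of the identity lies in `genOp U A` for every `A ∈ U`, so applying the reduction to
`i` yields one value that works for all `A` at once. -/
theorem realizerLE_of_LTLE {U V : Set (Set ℕ)} (h : LTLE (basicTopology U) (basicTopology V)) :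
    RealizerLE U V := by
  obtain ⟨e, he⟩ := (isLeastLTTopologyAbove_basicTopology U).above.trans h
  obtain ⟨i, hi⟩ := exists_id_rimp
  by_cases hU : U.Nonempty
  · obtain ⟨A₀, hA₀⟩ := hU
    obtain ⟨t, ht, -⟩ := he A₀ i (Set.mem_iUnion₂.2 ⟨A₀, hA₀, hi A₀⟩)
    refine ⟨t, fun A hA => ?_⟩
    obtain ⟨t', ht', htA⟩ := he A i (Set.mem_iUnion₂.2 ⟨A, hA, hi A⟩)
    rwa [Part.mem_unique ht ht']
  · exact ⟨0, fun A hA => absurd ⟨A, hA⟩ hU⟩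

/-- By leastness only `genOp U` needs to be reduced: monotonicity turns `f ∈ rimp A p` into a
realiser of `j_V(A) → j_V(p)`, which is applied to `t`. -/
theorem LTLE_of_realizerLE {U V : Set (Set ℕ)} (h : RealizerLE U V) :
    LTLE (basicTopology U) (basicTopology V) := by
  obtain ⟨t, ht⟩ := h
  refine (isLeastLTTopologyAbove_basicTopology U).least _ (isLTTopology_basicTopology V) ?_
  obtain ⟨m, hm⟩ := (isLTTopology_basicTopology V).mono
  obtain ⟨e, he⟩ := exists_pcf_eq (f := fun f => (pcf m f).bind fun v => pcf v t)
    (Partrec.bind (partrec₂_pcf.comp (Computable.const m) Computable.id)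
      (partrec₂_pcf.comp₂ Computable.snd.to₂ (Computable.const t).to₂))
  refine ⟨e, fun p f hf => ?_⟩
  obtain ⟨A, hA, hf⟩ := Set.mem_iUnion₂.1 hf
  obtain ⟨v, hv, hvr⟩ := hm A p f hf
  obtain ⟨y, hy, hyp⟩ := hvr t (ht A hA)
  rw [he]
  exact ⟨y, Part.mem_bind_iff.2 ⟨v, hv, hy⟩, hyp⟩

/-- A self-referential program sends `σ` to its tagged output, or to a tagged index of `x ↦` (the
program at `σ ++ [x]`). Induction on the bar shows that its value lies in the basic topology, and
the value at `[]` does not depend on `A`. -/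
theorem RealizerLE.of_bar {U V : Set (Set ℕ)} {ψ : List ℕ →. ℕ} (hψ : Partrec ψ)
    (h : ∀ A ∈ U, Bar V (fun σ => ∃ y ∈ A, Nat.pair 1 y ∈ ψ σ)
      (fun σ => ∃ u, Nat.pair 0 u ∈ ψ σ) []) : RealizerLE U V := by
  obtain ⟨idx, hidx, hidx_eq⟩ := exists_computable_pcf_eq
    (f := fun (r : ℕ × List ℕ) x => pcf r.1 (Encodable.encode (r.2 ++ [x])))
    (partrec₂_pcf.comp (Computable.fst.comp Computable.fst) (Computable.encode.comp
      (Computable.list_concat.comp (Computable.snd.comp Computable.fst) Computable.snd)))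
  obtain ⟨e, he⟩ := exists_pcf_fixed_point
    (F := fun e (σ : List ℕ) => (ψ σ).map fun v : ℕ => bif decide (v.unpair.1 = 0)
      then Nat.pair 1 (idx (e, σ)) else Nat.pair 0 v.unpair.2) (by
    refine Partrec.map (hψ.comp Computable.snd) (Computable.cond ?_ ?_ ?_)
    · exact (Primrec.eq.decide.to_comp).comp
        (Computable.fst.comp (Computable.unpair.comp Computable.snd)) (Computable.const 0)
    · exact Primrec₂.natPair.to_comp.comp (Computable.const 1) (hidx.comp Computable.fst)
    · exact Primrec₂.natPair.to_comp.comp (Computable.const 0)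
        (Computable.snd.comp (Computable.unpair.comp Computable.snd)))
  have key : ∀ A σ, Bar V (fun σ => ∃ y ∈ A, Nat.pair 1 y ∈ ψ σ)
      (fun σ => ∃ u, Nat.pair 0 u ∈ ψ σ) σ →
      ∃ v ∈ pcf e (Encodable.encode σ), v ∈ basicTopology V A := by
    intro A σ hσ
    induction hσ with
    | reach σ h =>
      obtain ⟨y, hy, h⟩ := h
      rw [he]
      exact ⟨Nat.pair 0 y, (Part.mem_map_iff _).2 ⟨_, h, by simp⟩,
        pair_zero_mem_basicTopology V hy⟩
    | ask σ B hQ hB _ ih =>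
      obtain ⟨u, h⟩ := hQ
      rw [he]
      refine ⟨Nat.pair 1 (idx (e, σ)), (Part.mem_map_iff _).2 ⟨_, h, by simp⟩,
        pair_one_mem_basicTopology hB fun x hx => ?_⟩
      rw [hidx_eq]
      exact ih x hx
  by_cases hU : U.Nonempty
  · obtain ⟨A₀, hA₀⟩ := hU
    obtain ⟨t, ht, -⟩ := key A₀ [] (h A₀ hA₀)
    refine ⟨t, fun A hA => ?_⟩
    obtain ⟨t', ht', htA⟩ := key A [] (h A hA)
    rwa [Part.mem_unique ht ht']
  · exact ⟨0, fun A hA => absurd ⟨A, hA⟩ hU⟩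

/-- The number `t` is run as a strategy: the state is the current tagged number, and a query code is
applied to the answer to give the next state. Termination is the induction principle of the basic
topology. -/
theorem computableGamifiedKatetovLE_of_realizerLE {U V : Set (Set ℕ)} (hV : IsUpperFamily V)
    (h : RealizerLE U V) : ComputableGamifiedKatetovLE U V := by
  obtain ⟨t, ht⟩ := h
  -- a dummy first query makes the strategy start legally
  obtain ⟨d, hd⟩ := exists_pcf_eq (f := fun _ => Part.some t) (Computable.const t).partrec
  -- A halted state has no successor, which makes `ψ` undefined after an output.
  let f : ℕ → ℕ →. ℕ := fun v x =>
    bif decide (v.unpair.1 = 0) then Part.none else pcf v.unpair.2 x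
  have hf : Partrec₂ f := by
    refine Partrec.cond ?_ Partrec.none ?_
    · exact (Primrec.eq.decide.to_comp).comp
        (Computable.fst.comp (Computable.unpair.comp Computable.fst)) (Computable.const 0)
    · exact partrec₂_pcf.comp (Computable.snd.comp (Computable.unpair.comp Computable.fst))
        Computable.snd
  let s : List ℕ →. ℕ := fun σ =>
    σ.foldl (fun p x => p.bind fun v => f v x) (Part.some (Nat.pair 1 d))
  have hs : ∀ σ x, s (σ ++ [x]) = (s σ).bind fun v => f v x := by
    intro σ x
    simp [s]
  let ψ : List ℕ →. ℕ := fun σ => (s σ).map fun v => bif decide (v.unpair.1 = 0)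
      then Nat.pair 1 v.unpair.2 else 0
  have hψ : Partrec ψ := by
    refine Partrec.map (partrec_foldl hf _) (Computable.cond ?_ ?_ (Computable.const 0))
    · exact (Primrec.eq.decide.to_comp).comp
        (Computable.fst.comp (Computable.unpair.comp Computable.snd)) (Computable.const 0)
    · exact Primrec₂.natPair.to_comp.comp (Computable.const 1)
        (Computable.snd.comp (Computable.unpair.comp Computable.snd))
  have hout : ∀ σ a, Nat.pair 0 a ∈ s σ → Nat.pair 1 a ∈ ψ σ := fun σ a h =>
    (Part.mem_map_iff _).2 ⟨_, h, by simp⟩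
  have hask : ∀ σ b, Nat.pair 1 b ∈ s σ → 0 ∈ ψ σ := fun σ b h =>
    (Part.mem_map_iff _).2 ⟨_, h, by simp⟩
  have hdec : IsDecisionStrategy ψ := by
    refine ⟨hask [] d (Part.mem_some _), ?_, ?_⟩
    · intro σ v hv
      obtain ⟨w, -, rfl⟩ := (Part.mem_map_iff _).1 hv
      by_cases hw : w.unpair.1 = 0
      · exact .inr ⟨_, by simp [hw]; rfl⟩
      · exact .inl (by simp [hw])
    · rintro σ y _ hy ⟨ρ, rfl⟩ hne hdom
      obtain ⟨w, hw, hwy⟩ := (Part.mem_map_iff _).1 hy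
      have hw0 : w.unpair.1 = 0 := by
        by_contra h
        simp only [h, decide_false, cond_false] at hwy
        exact pair_one_ne_zero y hwy.symm
      have hnone : ∀ ρ, ρ ≠ [] → s (σ ++ ρ) = Part.none := by
        intro ρ
        induction ρ using List.reverseRecOn with
        | nil => exact fun h => absurd rfl h
        | append_singleton ρ x ih =>
          intro _
          rw [← List.append_assoc, hs]
          by_cases hρ : ρ = []
          · subst hρ
            rw [List.append_nil, Part.eq_some_iff.2 hw, Part.bind_some]
            simp [f, hw0]
          · rw [ih hρ, Part.bind_none]
      have hsd : (s (σ ++ ρ)).Dom := hdom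
      rw [hnone ρ (by rintro rfl; simp at hne)] at hsd
      exact hsd
  have hbar : ∀ A, ∀ v ∈ basicTopology V A, ∀ σ, v ∈ s σ →
      Bar V (fun σ => ∃ y ∈ A, Nat.pair 1 y ∈ ψ σ) (fun σ => 0 ∈ ψ σ) σ := by
    intro A v hv
    refine basicTopology_induction (P := fun v => ∀ σ, v ∈ s σ →
      Bar V (fun σ => ∃ y ∈ A, Nat.pair 1 y ∈ ψ σ) (fun σ => 0 ∈ ψ σ) σ) ?_ ?_ hv
    · exact fun a ha σ hσ => .reach _ ⟨a, ha, hout _ _ hσ⟩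
    · intro B hB b hb σ hσ
      refine .ask _ B (hask _ _ hσ) hB fun x hx => ?_
      obtain ⟨c, hc, hbar⟩ := hb x hx
      refine hbar _ ?_
      rw [hs]
      exact Part.mem_bind_iff.2 ⟨_, hσ, by simpa [f] using hc⟩
  obtain ⟨η, hη⟩ := hdec.exists_isWinningStrategy (U := U) (V := V) fun A hA =>
    hbar A _ (pair_one_mem_basicTopology hV.univ_mem fun x _ =>
      ⟨t, by rw [hd]; exact Part.mem_some _, ht A hA⟩) [] (Part.mem_some _)
  exact ⟨ψ, η, hψ, hη⟩

theorem ltGameLE_of_computableGamifiedKatetovLE {U V : Set (Set ℕ)}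
    (h : ComputableGamifiedKatetovLE U V) : LTGameLE (constSeq U) (constSeq V) := by
  obtain ⟨ψ, η, hψ, h⟩ := h
  have hpos : ∀ x₀ A σ, LTPosition (fun l => ψ l.tail) (fun r => η (r.1, r.2.tail)) x₀ A σ →
      σ ≠ [] ∧ GamePosition ψ η A σ.tail := by
    intro x₀ A σ hσ
    induction hσ with
    | start => exact ⟨by simp, .nil⟩
    | snoc σ u B x _ hu hB hx ih =>
      refine ⟨by simp, ?_⟩
      rw [List.tail_append_of_ne_nil ih.1]
      refine .snoc _ B x ih.2 ?_ hB hx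
      rcases h.decision.legal _ _ hu with h0 | ⟨y, hy⟩
      · rwa [← h0]
      · simp [Nat.pair_eq_pair] at hy
  refine ⟨fun l => ψ l.tail, fun r => η (r.1, r.2.tail),
    hψ.comp Primrec.list_tail.to_comp, ?_, ?_⟩
  · intro x₀ F hF A hA σ hσ
    obtain rfl : F = U := Part.mem_some_iff.1 hF
    obtain ⟨-, hp⟩ := hpos x₀ A σ hσ
    have hd := Part.get_mem (h.moves A hA _ hp)
    rcases h.decision.legal _ _ hd with h0 | ⟨y, hy⟩
    · rw [h0] at hd
      obtain ⟨B, hB, hBV⟩ := h.query A hA _ hp hd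
      -- `Nat.pair 0 0` reduces to `0`, so the query of Player II₀ is already Arthur's query with `u
      -- = 0`.
      exact .inl ⟨0, hd, V, Part.mem_some _, B, hB, hBV⟩
    · rw [hy] at hd
      exact .inr ⟨y, hd, h.valid A hA _ hp y hd⟩
  · intro x₀ F hF A hA x
    obtain rfl : F = U := Part.mem_some_iff.1 hF
    obtain ⟨n, hn⟩ := h.terminates A hA fun i => x (i + 1)
    refine ⟨n + 1, n.succ_pos, fun hp => hn ?_⟩
    have := (hpos _ _ _ hp).2
    rwa [tail_restr_succ] at this

/-- The sequences are constant, so Merlin's public opening carries no information and is fixed to be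
`0`. -/
theorem realizerLE_of_ltGameLE {U V : Set (Set ℕ)} (h : LTGameLE (constSeq U) (constSeq V)) :
    RealizerLE U V := by
  obtain ⟨φ, ν, h⟩ := h
  refine RealizerLE.of_bar (ψ := fun σ => φ (0 :: σ))
    (h.computable.comp (Computable.list_cons.comp (Computable.const 0) Computable.id))
    fun A hA => Bar.of_invariant (P := fun σ => LTPosition φ ν 0 A (0 :: σ)) .start ?_ ?_
  · intro σ hσ
    rcases h.moves 0 U (Part.mem_some _) A hA _ hσ with ⟨u, hu, G, hG, B, hB, hBG⟩ | ⟨u, hu, huA⟩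
    · obtain rfl : G = V := Part.mem_some_iff.1 hG
      exact .inr ⟨⟨u, hu⟩, B, hBG, fun x hx => .snoc _ u B x hσ hu hB hx⟩
    · exact .inl ⟨u, huA, hu⟩
  · intro x hx
    obtain ⟨n, hn0, hn⟩ := h.terminates 0 U (Part.mem_some _) A hA fun i => Nat.casesOn i 0 x
    obtain ⟨m, rfl⟩ := Nat.exists_eq_succ_of_ne_zero hn0.ne'
    rw [Nat.succ_eq_add_one, restr_cons] at hn
    exact absurd (hx m) hn

end GamKat

open GamKat in
theorem theoremA :
    -- the Gamified Katetov order is a preorder on upper sets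
    ((∀ U, IsUpperFamily U → GamifiedKatetovLE U U) ∧
      (∀ U V W, IsUpperFamily U → IsUpperFamily V → IsUpperFamily W →
        GamifiedKatetovLE U V → GamifiedKatetovLE V W → GamifiedKatetovLE U W)) ∧
    -- (i) it is the Katetov order closed under fence-indexed Fubini powers
    ((∀ U V, IsUpperFamily U → IsUpperFamily V →
        (GamifiedKatetovLE U V ↔ ∃ δ, IsFence V δ ∧ KatetovLE U (deltaFubini V δ))) ∧
      -- in particular, it does not distinguish an upper set from its Fubini square
      (∀ U, IsUpperFamily U → IsUpperFamily (fubini U U) ∧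
        GamifiedKatetovLE U (fubini U U) ∧ GamifiedKatetovLE (fubini U U) U) ∧
      -- and it is strictly coarser than the Katetov and Rudin-Keisler orders
      (∀ U V, IsUpperFamily U → IsUpperFamily V → KatetovLE U V → GamifiedKatetovLE U V) ∧
      (∀ U V, IsUpperFamily U → IsUpperFamily V → RudinKeislerLE U V → GamifiedKatetovLE U V) ∧
      (∃ U V, IsUpperFamily U ∧ IsUpperFamily V ∧ GamifiedKatetovLE U V ∧
        ¬ KatetovLE U V ∧ ¬ RudinKeislerLE U V)) ∧
    -- (ii) game characterisation
    (∀ U V, IsUpperFamily U → IsUpperFamily V →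
      (GamifiedKatetovLE U V ↔ PlayerIIWins U V)) ∧
    -- (iii) the computable version is the order of basic Lawvere-Tierney topologies
    ((∀ U, IsUpperFamily U → IsLeastLTTopologyAbove (genOp U) (basicTopology U)) ∧
      (∀ U V, IsUpperFamily U → IsUpperFamily V →
        (ComputableGamifiedKatetovLE U V ↔ LTLE (basicTopology U) (basicTopology V)) ∧
        (ComputableGamifiedKatetovLE U V ↔ LTGameLE (constSeq U) (constSeq V)))) := by
  have hst : ∀ {U V}, IsUpperFamily V → (GamifiedKatetovLE U V ↔ StoppingLE U V) := fun hV =>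
    ⟨stoppingLE_of_gamifiedKatetovLE hV, gamifiedKatetovLE_of_stoppingLE hV⟩
  have hkat : ∀ {U V}, IsUpperFamily V → KatetovLE U V → GamifiedKatetovLE U V := fun hV h =>
    (hst hV).2 (.of_katetovLE h)
  refine ⟨⟨fun U hU => hkat hU ⟨id, fun A hA => hA⟩, fun U V W _ hV hW h₁ h₂ =>
    (hst hW).2 (((hst hV).1 h₁).trans ((hst hW).1 h₂))⟩, ⟨?_, ?_, ?_, ?_, ?_⟩, ?_, ?_, ?_⟩
  · intro U V hU hV
    rw [hst hV]
    exact ⟨exists_fence_of_stoppingLE hU, fun ⟨δ, hδ, h⟩ => stoppingLE_of_fence hδ h hV⟩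
  · exact fun U hU => ⟨hU.fubini hU, hkat (hU.fubini hU) (katetovLE_fubini hU hU),
      (hst hU).2 (stoppingLE_fubini_self U)⟩
  · exact fun U V _ hV => hkat hV
  · exact fun U V _ hV h => hkat hV h.katetovLE
  · have hc := isUpperFamily_cofiniteFamily
    exact ⟨fubini cofiniteFamily cofiniteFamily, cofiniteFamily, hc.fubini hc, hc,
      (hst hc).2 (stoppingLE_fubini_self _), not_katetovLE_fubini_cofiniteFamily,
      fun h => not_katetovLE_fubini_cofiniteFamily h.katetovLE⟩
  · intro U V _ hV
    rw [hst hV]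
    exact ⟨playerIIWins_of_stoppingLE, stoppingLE_of_playerIIWins⟩
  · exact fun U _ => isLeastLTTopologyAbove_basicTopology U
  · intro U V _ hV
    -- All equivalences pass through `RealizerLE`: strategies give realisers by way of the LT-game,
    -- and realisers give strategies.
    have hgame : LTGameLE (constSeq U) (constSeq V) → ComputableGamifiedKatetovLE U V := fun h =>
      computableGamifiedKatetovLE_of_realizerLE hV (realizerLE_of_ltGameLE h)
    exact ⟨⟨fun h => LTLE_of_realizerLE (realizerLE_of_ltGameLE
      (ltGameLE_of_computableGamifiedKatetovLE h)), fun h =>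
      computableGamifiedKatetovLE_of_realizerLE hV (realizerLE_of_LTLE h)⟩,
      ltGameLE_of_computableGamifiedKatetovLE, hgame⟩
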